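/- Consider the following Markov decision process for the age of information of a single user. In each slot $t=0,1,2,\dots$ the state is $(X(t),\Lambda(t))$, where $X(t)\in\{1,2,\dots\}$ is the age and $\Lambda(t)\in\{0,1\}$ indicates whether a packet arrives; an action $a(t)\in\{0,1\}$ is chosen ($1$: update, $0$: idle). If $(X(t),\Lambda(t))=(x,\lambda)$ and $a(t)=a$, then $X(t+1)=1$ if $a=\lambda=1$ and $X(t+1)=x+1$ otherwise, while $\Lambda(t+1)$ is a Bernoulli variable with parameter $p\in[0,1]$, independent of the past; the immediate cost is $(x+1-x\,a\,\lambda)+C\,a$, where $C\in\mathbb{R}$. A policy chooses the action of each slot, possibly at random, depending on the current state and on all past states and actions. Its average cost from an initial state is $\limsup_{T\to\infty}\frac{1}{T+1}E\big[\sum_{t=0}^{T}\mathrm{cost}(t)\big]\in[0,\infty]$ for $C\ge 0$, where $\mathrm{cost}(t)$ is the immediate cost in slot $t$. If $C\ge 0$, then there exist a threshold $\bar X\in\{1,2,\dots\}$ and a stationary deterministic policy which updates in state $(x,\lambda)$ exactly when $\lambda=1$ and $x\ge\bar X$ (and idles otherwise), such that for every initial state its average cost is at most that of every policy (history dependent and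 randomized ones included). -/

import Mathlib

open scoped ENNReal

namespace AgeMDP

/-- A state `(x, l)`: the age `x ∈ {1, 2, …}` before the decision, and the arrival indicator `l`
(`true` if a packet arrives in the slot). -/
abbrev State := ℕ+ × Bool

/-- `true` is "update", `false` is "idle". -/
abbrev Action := Bool

/-- The numerical value `1` or `0` of an indicator. -/
def ind (b : Bool) : ℝ := if b then 1 else 0

/-- The immediate cost `(x + 1 - x * a * l) + C * a` of action `a` in state `(x, l)`. -/
def cost (C : ℝ) (s : State) (a : Action) : ℝ :=
  ((s.1 : ℕ) + 1 - (s.1 : ℕ) * ind a * ind s.2) + C * ind a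

/-- The Bernoulli law of the arrival indicator: an arrival has probability `p`. -/
noncomputable def arrivalLaw (p : unitInterval) : PMF Bool :=
  PMF.ofFintype (fun b => ENNReal.ofReal (if b then (p : ℝ) else 1 - p)) (by
    rw [Fintype.sum_bool]
    simp only [if_true, Bool.false_eq_true, if_false]
    rw [← ENNReal.ofReal_add p.2.1 (sub_nonneg.2 p.2.2)]
    simp)

/-- The next age is `1` if the user is updated with an arriving packet, and `x + 1` otherwise. -/
def nextAge (s : State) (a : Action) : ℕ+ :=
  if s.2 = true ∧ a = true then 1 else s.1 + 1

/-- The transition law of the decision process: the age moves to `nextAge s a`, and the next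
arrival indicator is a fresh Bernoulli variable. -/
noncomputable def transition (p : unitInterval) (s : State) (a : Action) : PMF State :=
  (arrivalLaw p).map fun l => (nextAge s a, l)

/-- The state-action pairs of the past slots, the most recent one first. -/
abbrev History := List (State × Action)

/-- A policy (history dependent and randomized in general): in slot `t`, a probability
distribution on the actions, given the `t` past state-action pairs and the current state. -/
abbrev Policy := History → State → PMF Action

/-- The stationary deterministic policy that takes the action `f s` in state `s`. -/
noncomputable def stationary (f : State → Action) : Policy := fun _ s => PMF.pure (f s)

/-- The joint law of `(s(0), a(0), …, s(t-1), a(t-1))` and `s(t)` under the policy `μ`, started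
from `s(0) = s₀`. -/
noncomputable def pathLaw (p : unitInterval) (μ : Policy) (s₀ : State) :
    ℕ → PMF (History × State)
  | 0 => PMF.pure ([], s₀)
  | t + 1 => (pathLaw p μ s₀ t).bind fun ω =>
      (μ ω.1 ω.2).bind fun a =>
        (transition p ω.2 a).map fun s' => ((ω.2, a) :: ω.1, s')

/-- The sum of the immediate costs over a history. -/
def totalCost (C : ℝ) (h : History) : ℝ := (h.map fun z => cost C z.1 z.2).sum

/-- For `0 ≤ C`, the expectation of the total cost over the slots `0, …, T` under `μ`, given
`s(0) = s₀`. Immediate costs are then nonnegative, so the expectation is a sum in `[0, ∞]`. -/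
noncomputable def expectedCost (p : unitInterval) (C : ℝ) (μ : Policy) (s₀ : State) (T : ℕ) :
    ℝ≥0∞ :=
  ∑' ω : History × State, pathLaw p μ s₀ (T + 1) ω * ENNReal.ofReal (totalCost C ω.1)

/-- The average cost (in `[0, ∞]`) of `μ` from the initial state `s₀`, for `0 ≤ C`. -/
noncomputable def averageCost (p : unitInterval) (C : ℝ) (μ : Policy) (s₀ : State) : ℝ≥0∞ :=
  Filter.limsup (fun T : ℕ => expectedCost p C μ s₀ T / ((T : ℝ≥0∞) + 1)) Filter.atTop

/-- `μ` minimizes the average cost, among all policies, from every initial state. -/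
def IsCostOptimal (p : unitInterval) (C : ℝ) (μ : Policy) : Prop :=
  ∀ (s₀ : State) (ν : Policy), averageCost p C μ s₀ ≤ averageCost p C ν s₀

/-- A threshold-type policy: stationary and deterministic, and for some threshold
`X ∈ {1, 2, …}` it updates exactly when there is an arrival and the age is at least `X`. -/
def IsThresholdType (μ : Policy) : Prop :=
  ∃ f : State → Action, μ = stationary f ∧
    ∃ X : ℕ+, ∀ (x : ℕ+) (l : Bool), f (x, l) = true ↔ l = true ∧ X ≤ x

end AgeMDP

/-!
The proof solves the average cost optimality equation explicitly.

* **Verification.** Let `H ≥ 0` be a function on the states and `ρ ≥ 0` a constant with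
  `ρ + H s ≤ cost C s a + E[H s']`, where `s'` is the state after action `a` in state `s`.
  Summing along a path, the expected cost `A t` of the first `t` slots and the state `S t`
  satisfy `t * ρ + H s₀ ≤ A t + E[H (S t)]` for every policy, with equality for a stationary policy
  attaining equality in each state. As `H ≥ 0`, the latter has average cost at most `ρ`
  (`averageCost_stationary_le`). For the lower bound let `H ≤ K * age`. The immediate cost is at
  least the next age, so `E[age (S (t + 1))] ≤ A (t + 1) - A t`, and hence
  `(t + 1) * ρ ≤ A (t + 1) + K * (A (t + 1) - A t)`. This recursion is incompatible with
  `A t ≤ r * t` for large `t` and `r < ρ` (`le_averageCost`).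
* **Solution for `0 < p`.** Averaging over the arrival, the relative value `V x` of age `x` has
  to satisfy `ρ + V x = p * min (x + 1 + V (x + 1)) (1 + C) + (1 - p) * (x + 1 + V (x + 1))` and
  `V 1 = 0`. For a threshold `m`, it is quadratic below `m` and affine above; gluing the two
  pieces determines `ρ`. The minimum is attained as the threshold prescribes if `m` is
  the least number satisfying a quadratic inequality (`exists_relativeValue`).
* **The case `p = 0`.** No packet arrives after slot `0`, every `ρ` admits a subsolution, and all
  policies have infinite average cost.
-/

namespace AgeMDP

/-! ### Expectations under a probability mass function -/

/-- The expectation in `[0, ∞]` of `g` under `P`. -/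
noncomputable def expect {α : Type*} (P : PMF α) (g : α → ℝ≥0∞) : ℝ≥0∞ := ∑' a, P a * g a

section expect

variable {α β : Type*}

lemma expect_pure (a : α) (g : α → ℝ≥0∞) : expect (PMF.pure a) g = g a := by
  unfold expect
  rw [tsum_eq_single a]
  · simp
  · intro b hb
    simp [PMF.pure_apply, hb]

lemma expect_bind (P : PMF α) (k : α → PMF β) (g : β → ℝ≥0∞) :
    expect (P.bind k) g = expect P fun a => expect (k a) g := by
  simp only [expect, PMF.bind_apply, ← ENNReal.tsum_mul_right, ← ENNReal.tsum_mul_left]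
  rw [ENNReal.tsum_comm]
  simp only [mul_assoc]

lemma expect_map (P : PMF α) (k : α → β) (g : β → ℝ≥0∞) :
    expect (P.map k) g = expect P fun a => g (k a) := by
  rw [PMF.map, expect_bind]
  simp only [Function.comp_apply, expect_pure]

lemma expect_mono (P : PMF α) {g g' : α → ℝ≥0∞} (h : ∀ a, g a ≤ g' a) :
    expect P g ≤ expect P g' :=
  ENNReal.tsum_le_tsum fun a => mul_le_mul_right (h a) _

lemma expect_add (P : PMF α) (g g' : α → ℝ≥0∞) :
    expect P (fun a => g a + g' a) = expect P g + expect P g' := by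
  simp only [expect, mul_add, ENNReal.tsum_add]

lemma expect_const_mul (P : PMF α) (c : ℝ≥0∞) (g : α → ℝ≥0∞) :
    expect P (fun a => c * g a) = c * expect P g := by
  simp only [expect, ← ENNReal.tsum_mul_left, mul_left_comm]

lemma expect_const (P : PMF α) (c : ℝ≥0∞) : expect P (fun _ => c) = c := by
  simp only [expect, ENNReal.tsum_mul_right, PMF.tsum_coe, one_mul]

end expect

/-! ### The decision process -/

lemma expect_transition (p : unitInterval) (s : State) (a : Action) (H : State → ℝ)
    (hH : ∀ s, 0 ≤ H s) :
    expect (transition p s a) (fun s' => ENNReal.ofReal (H s')) =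
      ENNReal.ofReal ((p : ℝ) * H (nextAge s a, true) + (1 - p) * H (nextAge s a, false)) := by
  have hp : (0 : ℝ) ≤ p := p.2.1
  have hq : (0 : ℝ) ≤ 1 - p := sub_nonneg.2 p.2.2
  rw [transition, expect_map, expect, tsum_fintype, Fintype.sum_bool,
    ENNReal.ofReal_add (mul_nonneg hp (hH _)) (mul_nonneg hq (hH _)),
    ENNReal.ofReal_mul hp, ENNReal.ofReal_mul hq]
  simp [arrivalLaw]

lemma expect_transition_age (p : unitInterval) (s : State) (a : Action) :
    expect (transition p s a) (fun s' => ((s'.1 : ℕ) : ℝ≥0∞)) = ((nextAge s a : ℕ) : ℝ≥0∞) := by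
  rw [transition, expect_map]
  exact expect_const (arrivalLaw p) ((nextAge s a : ℕ) : ℝ≥0∞)

/-- The immediate cost dominates the next age, which therefore cannot be large on average when
the costs are not. -/
lemma nextAge_le_cost {C : ℝ} (hC : 0 ≤ C) (s : State) (a : Action) :
    ((nextAge s a : ℕ) : ℝ) ≤ cost C s a := by
  obtain ⟨x, l⟩ := s
  cases l <;> cases a <;> simp [nextAge, cost, ind, hC]

lemma cost_nonneg {C : ℝ} (hC : 0 ≤ C) (s : State) (a : Action) : 0 ≤ cost C s a :=
  (Nat.cast_nonneg _).trans (nextAge_le_cost hC s a)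

lemma totalCost_nonneg {C : ℝ} (hC : 0 ≤ C) (h : History) : 0 ≤ totalCost C h := by
  refine List.sum_nonneg fun y hy => ?_
  obtain ⟨z, -, rfl⟩ := List.mem_map.1 hy
  exact cost_nonneg hC _ _

lemma ofReal_totalCost_cons {C : ℝ} (hC : 0 ≤ C) (z : State × Action) (h : History) :
    ENNReal.ofReal (totalCost C (z :: h)) =
      ENNReal.ofReal (totalCost C h) + ENNReal.ofReal (cost C z.1 z.2) := by
  rw [← ENNReal.ofReal_add (totalCost_nonneg hC h) (cost_nonneg hC _ _), add_comm]
  simp [totalCost]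

lemma expect_pathLaw_succ (p : unitInterval) (μ : Policy) (s₀ : State) (t : ℕ)
    (g : History × State → ℝ≥0∞) :
    expect (pathLaw p μ s₀ (t + 1)) g = expect (pathLaw p μ s₀ t) fun ω =>
      expect (μ ω.1 ω.2) fun a => expect (transition p ω.2 a) fun s' =>
        g ((ω.2, a) :: ω.1, s') := by
  simp only [pathLaw, expect_bind, expect_map]

/-- The expected cost of the first `t` slots. -/
noncomputable def costUpTo (p : unitInterval) (C : ℝ) (μ : Policy) (s₀ : State) (t : ℕ) : ℝ≥0∞ :=
  expect (pathLaw p μ s₀ t) fun ω => ENNReal.ofReal (totalCost C ω.1)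

/-- The expectation of `H` at the state of slot `t`. -/
noncomputable def expectState (p : unitInterval) (μ : Policy) (s₀ : State) (H : State → ℝ≥0∞)
    (t : ℕ) : ℝ≥0∞ :=
  expect (pathLaw p μ s₀ t) fun ω => H ω.2

lemma averageCost_eq (p : unitInterval) (C : ℝ) (μ : Policy) (s₀ : State) :
    averageCost p C μ s₀ = Filter.limsup
      (fun T : ℕ => costUpTo p C μ s₀ (T + 1) / ((T : ℝ≥0∞) + 1)) Filter.atTop := rfl

lemma costUpTo_add_expectState_zero (p : unitInterval) (C : ℝ) (μ : Policy) (s₀ : State)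
    (H : State → ℝ≥0∞) : costUpTo p C μ s₀ 0 + expectState p μ s₀ H 0 = H s₀ := by
  simp [costUpTo, expectState, pathLaw, expect_pure, totalCost]

/-- One step of the process, with the action and the next state integrated out. -/
lemma costUpTo_add_expectState_succ (p : unitInterval) {C : ℝ} (hC : 0 ≤ C) (μ : Policy)
    (s₀ : State) (H : State → ℝ≥0∞) (t : ℕ) :
    costUpTo p C μ s₀ (t + 1) + expectState p μ s₀ H (t + 1) =
      costUpTo p C μ s₀ t + expect (pathLaw p μ s₀ t) fun ω => expect (μ ω.1 ω.2) fun a =>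
        ENNReal.ofReal (cost C ω.2 a) + expect (transition p ω.2 a) H := by
  simp only [costUpTo, expectState, expect_pathLaw_succ, ofReal_totalCost_cons hC, expect_add,
    expect_const]
  ring

lemma costUpTo_add_age_le (p : unitInterval) {C : ℝ} (hC : 0 ≤ C) (μ : Policy)
    (s₀ : State) (t : ℕ) :
    costUpTo p C μ s₀ t + expectState p μ s₀ (fun s => ((s.1 : ℕ) : ℝ≥0∞)) (t + 1) ≤
      costUpTo p C μ s₀ (t + 1) := by
  have h := costUpTo_add_expectState_succ p hC μ s₀ (fun _ => 0) t
  simp only [expectState, expect_const, add_zero] at h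
  rw [h, expectState, expect_pathLaw_succ]
  gcongr
  refine expect_mono _ fun ω => expect_mono _ fun a => ?_
  rw [expect_transition_age, ← ENNReal.ofReal_natCast]
  exact ENNReal.ofReal_le_ofReal (nextAge_le_cost hC _ _)

/-! ### Verification -/

/-- Paths cost at least `ρ` per slot up to the boundary terms given by a subsolution `H`. -/
lemma mul_add_le_costUpTo_add (p : unitInterval) {C : ℝ} (hC : 0 ≤ C) (μ : Policy) (s₀ : State)
    {ρ : ℝ≥0∞} {H : State → ℝ≥0∞}
    (hH : ∀ s a, ρ + H s ≤ ENNReal.ofReal (cost C s a) + expect (transition p s a) H) (t : ℕ) :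
    t * ρ + H s₀ ≤ costUpTo p C μ s₀ t + expectState p μ s₀ H t := by
  induction t with
  | zero => simp [costUpTo_add_expectState_zero]
  | succ t ih =>
    rw [costUpTo_add_expectState_succ p hC]
    calc ((t + 1 : ℕ) : ℝ≥0∞) * ρ + H s₀ = (t * ρ + H s₀) + ρ := by push_cast; ring
      _ ≤ (costUpTo p C μ s₀ t + expectState p μ s₀ H t) + ρ := by gcongr
      _ = costUpTo p C μ s₀ t + expect (pathLaw p μ s₀ t) (fun ω => expect (μ ω.1 ω.2) fun _ =>
            ρ + H ω.2) := by
          simp only [expect_const, expect_add, expectState]; ring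
      _ ≤ _ := by
          gcongr
          exact expect_mono _ fun ω => expect_mono _ fun a => hH _ _

lemma costUpTo_stationary_add (p : unitInterval) {C : ℝ} (hC : 0 ≤ C) (f : State → Action)
    (s₀ : State) {ρ : ℝ≥0∞} {H : State → ℝ≥0∞}
    (hH : ∀ s, ENNReal.ofReal (cost C s (f s)) + expect (transition p s (f s)) H = ρ + H s)
    (t : ℕ) :
    costUpTo p C (stationary f) s₀ t + expectState p (stationary f) s₀ H t = t * ρ + H s₀ := by
  induction t with
  | zero => simp [costUpTo_add_expectState_zero]
  | succ t ih =>
    rw [costUpTo_add_expectState_succ p hC]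
    simp only [stationary, expect_pure, hH, expect_add, expect_const]
    rw [show ((t + 1 : ℕ) : ℝ≥0∞) * ρ + H s₀ = ρ + (t * ρ + H s₀) by push_cast; ring, ← ih]
    simp only [expectState]
    ring

lemma averageCost_stationary_le (p : unitInterval) {C : ℝ} (hC : 0 ≤ C) (f : State → Action)
    (s₀ : State) {ρ : ℝ≥0∞} {H : State → ℝ≥0∞} (hfin : H s₀ ≠ ⊤)
    (hH : ∀ s, ENNReal.ofReal (cost C s (f s)) + expect (transition p s (f s)) H = ρ + H s) :
    averageCost p C (stationary f) s₀ ≤ ρ := by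
  have hlim : Filter.Tendsto (fun T : ℕ => ρ + H s₀ / ((T : ℝ≥0∞) + 1)) Filter.atTop
      (nhds (ρ + 0)) := by
    refine tendsto_const_nhds.add ?_
    have h := (Filter.tendsto_add_atTop_iff_nat 1).2
      (ENNReal.Tendsto.const_mul ENNReal.tendsto_inv_nat_nhds_zero (Or.inr hfin))
    simpa [div_eq_mul_inv] using h
  rw [averageCost_eq]
  refine (Filter.limsup_le_limsup (Filter.Eventually.of_forall fun T => ?_)).trans
    (hlim.limsup_eq.trans (add_zero ρ)).le
  refine ENNReal.div_le_of_le_mul ?_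
  have h0 : (T : ℝ≥0∞) + 1 ≠ 0 := by simp
  have h1 : (T : ℝ≥0∞) + 1 ≠ ⊤ := by simp
  rw [add_mul, ENNReal.div_mul_cancel h0 h1]
  calc costUpTo p C (stationary f) s₀ (T + 1)
      ≤ _ := le_self_add.trans (costUpTo_stationary_add p hC f s₀ hH (T + 1)).le
    _ = _ := by push_cast; ring

/-- If `A` satisfies `ρ * (t + 1) + K * A t ≤ (1 + K) * A (t + 1)`, then `A t` cannot stay below
`r * t` with `r < ρ`: the gap `r * t - A t` would eventually decrease by `1` in each step. -/
lemma false_of_recursion_of_le {A : ℕ → ℝ} {K ρ r : ℝ} (hK : 0 ≤ K) (hr : r < ρ)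
    (hA : ∀ t : ℕ, ρ * (t + 1) + K * A t ≤ (1 + K) * A (t + 1)) {t₀ : ℕ}
    (hle : ∀ t, t₀ ≤ t → A t ≤ r * t) : False := by
  obtain ⟨n, hn⟩ := exists_nat_gt ((K * r + 1 + K) / (ρ - r))
  rw [div_lt_iff₀ (sub_pos.2 hr)] at hn
  set t₁ := max t₀ n
  have hstep : ∀ t, t₁ ≤ t → r * ((t + 1 : ℕ) : ℝ) - A (t + 1) ≤ r * t - A t - 1 := by
    intro t ht
    have h1 := hA t
    have h2 := hle t ((le_max_left _ _).trans ht)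
    have h3 : (n : ℝ) ≤ t := by exact_mod_cast (le_max_right t₀ n).trans ht
    have h4 : (n : ℝ) * (ρ - r) ≤ t * (ρ - r) := mul_le_mul_of_nonneg_right h3 (by linarith)
    push_cast
    have h5 : (1 + K) * (r * (t + 1) - A (t + 1)) ≤ (1 + K) * (r * t - A t - 1) := by
      nlinarith
    exact le_of_mul_le_mul_left h5 (by linarith)
  have hdown : ∀ j : ℕ, r * ((t₁ + j : ℕ) : ℝ) - A (t₁ + j) ≤ r * t₁ - A t₁ - j := by
    intro j
    induction j with
    | zero => simp
    | succ j ih =>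
      have := hstep (t₁ + j) (Nat.le_add_right _ _)
      rw [← add_assoc]
      push_cast at *
      linarith
  obtain ⟨j, hj⟩ := exists_nat_gt (r * t₁ - A t₁)
  have h1 := hdown j
  have h2 := hle (t₁ + j) ((le_max_left _ _).trans (Nat.le_add_right _ _))
  linarith

/-- A subsolution that grows at most linearly in the age bounds the average cost of every policy
from below. -/
lemma le_averageCost (p : unitInterval) {C : ℝ} (hC : 0 ≤ C) (μ : Policy) (s₀ : State)
    {ρ K : ℝ} (hK : 0 ≤ K) {H : State → ℝ≥0∞}
    (hHK : ∀ s, H s ≤ ENNReal.ofReal K * ((s.1 : ℕ) : ℝ≥0∞))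
    (hH : ∀ s a, ENNReal.ofReal ρ + H s ≤
      ENNReal.ofReal (cost C s a) + expect (transition p s a) H) :
    ENNReal.ofReal ρ ≤ averageCost p C μ s₀ := by
  by_contra! hlt
  obtain ⟨r, hr₁, hr₂⟩ := ENNReal.lt_iff_exists_nnreal_btwn.1 hlt
  have hrρ : (r : ℝ) < ρ := by
    rw [← ENNReal.ofReal_coe_nnreal] at hr₂
    exact ENNReal.ofReal_lt_ofReal_iff'.1 hr₂ |>.1
  have hρ : 0 ≤ ρ := r.2.trans hrρ.le
  rw [averageCost_eq] at hr₁
  obtain ⟨t₀, ht₀⟩ := Filter.eventually_atTop.1 (Filter.eventually_lt_of_limsup_lt hr₁)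
  set A := costUpTo p C μ s₀
  have hage := costUpTo_add_age_le p hC μ s₀
  have hle : ∀ t, t₀ + 1 ≤ t → A t ≤ r * t := by
    intro t ht
    obtain ⟨T, rfl⟩ : ∃ T, t = T + 1 := ⟨t - 1, by omega⟩
    have h := (ht₀ T (by omega)).le
    rw [ENNReal.div_le_iff (by simp) (by simp)] at h
    simpa using h
  have hmono : Monotone A := monotone_nat_of_le_succ fun t => le_self_add.trans (hage t)
  have hfin : ∀ t, A t ≠ ⊤ := fun t =>
    ne_top_of_le_ne_top (ENNReal.mul_ne_top ENNReal.coe_ne_top (ENNReal.natCast_ne_top _))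
      ((hmono (le_max_right (t₀ + 1) t)).trans (hle _ (le_max_left _ _)))
  have hrec : ∀ t : ℕ, ENNReal.ofReal ρ * (t + 1) + ENNReal.ofReal K * A t ≤
      (1 + ENNReal.ofReal K) * A (t + 1) := by
    intro t
    have h1 := le_self_add.trans (mul_add_le_costUpTo_add p hC μ s₀ hH (t + 1))
    have h2 : expectState p μ s₀ H (t + 1) ≤ ENNReal.ofReal K *
        expectState p μ s₀ (fun s => ((s.1 : ℕ) : ℝ≥0∞)) (t + 1) := by
      rw [expectState, expectState, ← expect_const_mul]
      exact expect_mono _ fun ω => hHK _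
    calc ENNReal.ofReal ρ * (t + 1) + ENNReal.ofReal K * A t
        = ((t + 1 : ℕ) : ℝ≥0∞) * ENNReal.ofReal ρ + ENNReal.ofReal K * A t := by
          push_cast; ring
      _ ≤ A (t + 1) + ENNReal.ofReal K *
            expectState p μ s₀ (fun s => ((s.1 : ℕ) : ℝ≥0∞)) (t + 1) +
            ENNReal.ofReal K * A t := by
          gcongr
          exact h1.trans (by gcongr)
      _ = A (t + 1) + ENNReal.ofReal K * (A t +
            expectState p μ s₀ (fun s => ((s.1 : ℕ) : ℝ≥0∞)) (t + 1)) := by ring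
      _ ≤ A (t + 1) + ENNReal.ofReal K * A (t + 1) := by
          gcongr
          exact hage t
      _ = _ := by ring
  refine false_of_recursion_of_le (A := fun t => (A t).toReal) hK hrρ (fun t => ?_)
    (t₀ := t₀ + 1) fun t ht => ?_
  · have h := hrec t
    rw [← ENNReal.ofReal_toReal (hfin t), ← ENNReal.ofReal_toReal (hfin (t + 1)),
      ← ENNReal.ofReal_one, ← ENNReal.ofReal_natCast,
      ← ENNReal.ofReal_add (by positivity) (by positivity),
      ← ENNReal.ofReal_add (by positivity) hK, ← ENNReal.ofReal_mul hρ, ← ENNReal.ofReal_mul hK,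
      ← ENNReal.ofReal_mul (by positivity),
      ← ENNReal.ofReal_add (by positivity) (by positivity)] at h
    exact (ENNReal.ofReal_le_ofReal_iff (by positivity)).1 h
  · have h := ENNReal.toReal_mono (ENNReal.mul_ne_top ENNReal.coe_ne_top
      (ENNReal.natCast_ne_top t)) (hle t ht)
    simpa using h

/-- `le_averageCost` in terms of real-valued data, with the expectation written out. -/
lemma le_averageCost_of_real (p : unitInterval) {C : ℝ} (hC : 0 ≤ C) (μ : Policy) (s₀ : State)
    {ρ K : ℝ} (hρ : 0 ≤ ρ) (hK : 0 ≤ K) {H : State → ℝ} (hH0 : ∀ s, 0 ≤ H s)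
    (hHK : ∀ s, H s ≤ K * (s.1 : ℕ))
    (hH : ∀ s a, ρ + H s ≤ cost C s a +
      ((p : ℝ) * H (nextAge s a, true) + (1 - p) * H (nextAge s a, false))) :
    ENNReal.ofReal ρ ≤ averageCost p C μ s₀ := by
  refine le_averageCost p hC μ s₀ hK (H := fun s => ENNReal.ofReal (H s)) (fun s => ?_)
    fun s a => ?_
  · rw [← ENNReal.ofReal_natCast, ← ENNReal.ofReal_mul hK]
    exact ENNReal.ofReal_le_ofReal (hHK s)
  · have hq : (0 : ℝ) ≤ 1 - p := sub_nonneg.2 p.2.2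
    rw [expect_transition p s a H hH0, ← ENNReal.ofReal_add hρ (hH0 s),
      ← ENNReal.ofReal_add (cost_nonneg hC s a)
        (add_nonneg (mul_nonneg p.2.1 (hH0 _)) (mul_nonneg hq (hH0 _)))]
    exact ENNReal.ofReal_le_ofReal (hH s a)

/-! ### No arrivals -/

/-- Without arrivals the age grows forever, and every `ρ` has a subsolution: at ages at which the
cost `x + 1` of idling falls short of `ρ`, `H` increases by the difference. -/
lemma averageCost_eq_top_of_eq_zero {C : ℝ} (hC : 0 ≤ C) (μ : Policy) (s₀ : State) :
    averageCost 0 C μ s₀ = ⊤ := by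
  refine ENNReal.eq_top_of_forall_nnreal_le fun ρ => ?_
  rw [← ENNReal.ofReal_coe_nnreal]
  set S : ℕ → ℝ := fun x => ∑ k ∈ Finset.range x, max (ρ - k - 1 : ℝ) 0 with hS
  have hS0 : ∀ x, 0 ≤ S x := fun x => Finset.sum_nonneg fun k _ => le_max_right _ _
  have hρ : (0 : ℝ) ≤ ρ := ρ.2
  have hsucc : ∀ x : ℕ, S (x + 1) = S x + max (ρ - x - 1 : ℝ) 0 :=
    fun x => Finset.sum_range_succ _ _
  -- At an arrival `H` vanishes, so that the one possible update in slot `0` does no harm.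
  set H : State → ℝ := fun s => if s.2 then 0 else ρ + S s.1 with hHdef
  refine le_averageCost_of_real 0 hC μ s₀ hρ (K := ρ + ρ) (by positivity) (H := H)
    (fun s => ?_) (fun s => ?_) fun s a => ?_
  · obtain ⟨x, l⟩ := s
    cases l
    · simpa [hHdef] using add_nonneg hρ (hS0 x)
    · simp [hHdef]
  · obtain ⟨x, l⟩ := s
    have hx : (1 : ℝ) ≤ (x : ℕ) := Nat.one_le_cast.2 x.pos
    cases l
    · have h : S x ≤ (x : ℕ) * (ρ : ℝ) := by
        have := Finset.sum_le_card_nsmul (Finset.range x) (fun k : ℕ => max (ρ - k - 1 : ℝ) 0) ρ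
          fun k _ => max_le (by have : (0 : ℝ) ≤ k := k.cast_nonneg; linarith) hρ
        simpa using this
      simp only [hHdef, Bool.false_eq_true, if_false]
      nlinarith
    · simp only [hHdef, if_true]
      positivity
  · obtain ⟨x, l⟩ := s
    have h1 := hsucc x
    have h2 := le_max_left (ρ - (x : ℕ) - 1 : ℝ) 0
    have h3 := hS0 1
    have h4 := hS0 (x + 1)
    have hx : (0 : ℝ) ≤ (x : ℕ) := Nat.cast_nonneg _
    cases l <;> cases a <;> simp [hHdef, cost, nextAge, ind] <;> linarith

/-! ### The relative value function -/

/-- The optimality equation averaged over the arrival: for `0 < p` there are a threshold `m`, an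
average cost `ρ` and a relative value function `V` of the age solving it, with the minimum of
idling and updating attained as `m` prescribes. -/
lemma exists_relativeValue {p C : ℝ} (hp : 0 < p) (hp1 : p ≤ 1) (hC : 0 ≤ C) :
    ∃ (m : ℕ) (ρ K : ℝ) (V : ℕ → ℝ), 1 ≤ m ∧ 0 ≤ ρ ∧ 0 ≤ K ∧ V 1 = 0 ∧
      ∀ x : ℕ, 1 ≤ x → 0 ≤ V x ∧ V x ≤ K * x ∧
        (p * min (x + 1 + V (x + 1)) (1 + C) + (1 - p) * (x + 1 + V (x + 1)) = ρ + V x) ∧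
        (m ≤ x → 1 + C ≤ x + 1 + V (x + 1)) ∧ (x < m → x + 1 + V (x + 1) ≤ 1 + C) := by
  obtain ⟨u, hu⟩ : ∃ u, u = p⁻¹ := ⟨_, rfl⟩
  have hu1 : 1 ≤ u := hu ▸ (one_le_inv₀ hp).2 hp1
  have hpu : p * u = 1 := by rw [hu, mul_inv_cancel₀ hp.ne']
  -- `N m` and `m - 1 + u` are the expected cost and duration of a renewal cycle.
  set N : ℕ → ℝ := fun m => (m - 1) * (m + 2) / 2 + (u - 1) * m + u * (u - 1) + 1 + C with hN
  have hex : ∃ m : ℕ, 1 ≤ m ∧ N m ≤ (m + u) * (m - 1 + u) := by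
    obtain ⟨n, hn⟩ := exists_nat_ge (1 + C)
    refine ⟨n + 1, by omega, ?_⟩
    simp only [hN]
    push_cast
    have : (0 : ℝ) ≤ n := n.cast_nonneg
    nlinarith [mul_nonneg this (sub_nonneg.2 hu1)]
  classical
  set m := Nat.find hex
  obtain ⟨hm1, hmN⟩ : 1 ≤ m ∧ N m ≤ (m + u) * (m - 1 + u) := Nat.find_spec hex
  have hm1' : (1 : ℝ) ≤ m := by exact_mod_cast hm1
  have hden : 0 < (m : ℝ) - 1 + u := by linarith
  have hN0 : 0 ≤ N m := by
    have h1 : 0 ≤ ((m : ℝ) - 1) * (m + 2) := mul_nonneg (by linarith) (by linarith)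
    have h2 : 0 ≤ (u - 1) * (m : ℝ) := mul_nonneg (by linarith) (by linarith)
    have h3 : 0 ≤ u * (u - 1) := mul_nonneg (by linarith) (by linarith)
    simp only [hN]
    linarith
  obtain ⟨ρ, hρ⟩ : ∃ ρ, ρ = N m / (m - 1 + u) := ⟨_, rfl⟩
  have hρN : ρ * (m - 1 + u) = N m := by rw [hρ, div_mul_cancel₀ _ hden.ne']
  have hρ0 : 0 ≤ ρ := hρ ▸ div_nonneg hN0 hden.le
  have hupper : ρ ≤ m + u := by rw [hρ]; exact (div_le_iff₀ hden).2 hmN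
  -- Minimality of `m`, with `N m = N (m - 1) + (m - 1 + u)`; no condition is needed if `m = 1`.
  have hlower : 2 ≤ m → (m : ℝ) - 1 + u ≤ ρ := by
    intro h2
    have hmin := Nat.find_min hex (m := m - 1) (by omega)
    rw [not_and, not_le] at hmin
    have h := hmin (by omega)
    rw [hρ, le_div_iff₀ hden]
    simp only [hN, Nat.cast_sub hm1, Nat.cast_one] at h ⊢
    nlinarith
  clear_value m
  set Q : ℕ → ℝ := fun x => (x - 1) * (ρ - (x + 2) / 2) with hQ
  set L : ℕ → ℝ := fun x => (u - 1) * x + u * (u - 1) + 1 + C - ρ * u with hL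
  set V : ℕ → ℝ := fun x => if x ≤ m then Q x else L x with hV
  have hglue : Q m = L m := by
    simp only [hQ, hL]
    simp only [hN] at hρN
    linarith
  have hVL : ∀ x, m ≤ x → V x = L x := by
    intro x hx
    rcases hx.eq_or_lt with rfl | hx
    · simp [hV, hglue]
    · simp [hV, not_le.2 hx]
  have hVQ : ∀ x, x ≤ m → V x = Q x := fun x hx => by simp [hV, hx]
  have hQ0 : ∀ x, 1 ≤ x → x ≤ m → 0 ≤ Q x := by
    intro x hx hxm
    have hxm' : (x : ℝ) ≤ m := by exact_mod_cast hxm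
    rcases hx.eq_or_lt with rfl | hx2
    · simp [hQ]
    · have hx' : (2 : ℝ) ≤ x := by exact_mod_cast hx2
      have := hlower (by omega)
      exact mul_nonneg (by linarith) (by linarith)
  have hL0 : ∀ x, m ≤ x → 0 ≤ L x := by
    intro x hx
    have h := hQ0 m hm1 le_rfl
    rw [hglue] at h
    have hx' : (m : ℝ) ≤ x := by exact_mod_cast hx
    have := mul_le_mul_of_nonneg_left hx' (sub_nonneg.2 hu1)
    simp only [hL] at h ⊢
    linarith
  have hidle : ∀ x, m ≤ x → 1 + C ≤ x + 1 + V (x + 1) := by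
    intro x hx
    have hx' : (m : ℝ) ≤ x := by exact_mod_cast hx
    rw [hVL _ (by omega)]
    simp only [hL]
    push_cast
    nlinarith
  have hupd : ∀ x, 1 ≤ x → x < m → x + 1 + V (x + 1) ≤ 1 + C := by
    intro x hx hxm
    have hlow := hlower (by omega)
    have hx' : (1 : ℝ) ≤ x := by exact_mod_cast hx
    have hxm' : (x : ℝ) + 1 ≤ m := by exact_mod_cast hxm
    -- `V` increases up to `m`, and at age `m - 1` the bound reads `m - 1 + u ≤ ρ`.
    have hmon : Q (x + 1) + x + 1 ≤ Q m + m := by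
      simp only [hQ]
      push_cast
      nlinarith
    have hend : L m + m ≤ 1 + C := by
      simp only [hL]
      nlinarith
    rw [hVQ _ (by omega)]
    linarith
  refine ⟨m, ρ, ρ + (u - 1 + u * (u - 1) + 1 + C), V, hm1, hρ0, ?_, ?_, fun x hx =>
    ⟨?_, ?_, ?_, hidle x, hupd x hx⟩⟩
  · nlinarith
  · rw [hVQ 1 hm1]; simp [hQ]
  · rcases le_total x m with h | h
    · rw [hVQ x h]; exact hQ0 x hx h
    · rw [hVL x h]; exact hL0 x h
  · have hx' : (1 : ℝ) ≤ x := by exact_mod_cast hx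
    have hc : 0 ≤ u * (u - 1) := mul_nonneg (by linarith) (by linarith)
    rcases le_total x m with h | h
    · rw [hVQ x h]
      have h1 : 0 ≤ (u - 1 + u * (u - 1) + 1 + C) * x := by
        apply mul_nonneg <;> linarith
      simp only [hQ]
      nlinarith
    · rw [hVL x h]
      have h1 : (u * (u - 1) + 1 + C) * 1 ≤ (u * (u - 1) + 1 + C) * x :=
        mul_le_mul_of_nonneg_left hx' (by linarith)
      have h2 : 0 ≤ ρ * u := mul_nonneg hρ0 (by linarith)
      have h3 : 0 ≤ ρ * x := mul_nonneg hρ0 (by linarith)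
      simp only [hL]
      linarith
  · rcases le_or_gt m x with h | h
    · rw [min_eq_right (hidle x h), hVL x h, hVL (x + 1) (by omega)]
      simp only [hL]
      push_cast
      linear_combination (-(x : ℝ) - 1 - (u - 1) + ρ) * hpu
    · rw [min_eq_left (hupd x hx h), hVQ x h.le, hVQ (x + 1) h]
      simp only [hQ]
      push_cast
      ring

lemma exists_isThresholdType_isCostOptimal {p : unitInterval} {C : ℝ} (hp : 0 < (p : ℝ))
    (hC : 0 ≤ C) : ∃ μ : Policy, IsThresholdType μ ∧ IsCostOptimal p C μ := by
  obtain ⟨m, ρ, K, V, hm, hρ, hK, hV1, hV⟩ := exists_relativeValue hp p.2.2 hC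
  have hq : (0 : ℝ) ≤ 1 - p := sub_nonneg.2 p.2.2
  -- The solution of the optimality equation, shifted by `ρ` so as to be nonnegative.
  set H : State → ℝ := fun s =>
    if s.2 then min ((s.1 : ℕ) + 1 + V ((s.1 : ℕ) + 1)) (1 + C)
    else (s.1 : ℕ) + 1 + V ((s.1 : ℕ) + 1) with hHdef
  have hidle0 : ∀ x : ℕ, 0 ≤ (x : ℝ) + 1 + V (x + 1) := fun x =>
    add_nonneg (by positivity) (hV (x + 1) (by omega)).1
  have hH0 : ∀ s, 0 ≤ H s := by
    rintro ⟨x, l⟩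
    have := hidle0 x
    cases l
    · simpa [hHdef] using this
    · simp only [hHdef, if_true]
      exact le_min this (by linarith)
  have hHle : ∀ s : State, H s ≤ (s.1 : ℕ) + 1 + V ((s.1 : ℕ) + 1) := by
    rintro ⟨x, l⟩
    cases l <;> simp [hHdef]
  have hHavg : ∀ x : ℕ+, (p : ℝ) * H (x, true) + (1 - p) * H (x, false) = ρ + V x := fun x => by
    simpa [hHdef] using (hV x x.pos).2.2.1
  have hsub : ∀ s a, ρ + H s ≤ cost C s a +
      ((p : ℝ) * H (nextAge s a, true) + (1 - p) * H (nextAge s a, false)) := by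
    rintro ⟨x, l⟩ a
    rw [hHavg]
    have h := hHle (x, l)
    -- A successful update leads to age `1`, where `V` vanishes; otherwise the age is `x + 1`.
    by_cases hla : l = true ∧ a = true
    · obtain ⟨rfl, rfl⟩ := hla
      have := min_le_right ((x : ℕ) + 1 + V ((x : ℕ) + 1)) (1 + C)
      simp [hHdef, cost, nextAge, ind, hV1]
      linarith
    · have : (x : ℕ) + 1 ≤ cost C (x, l) a := by
        cases l <;> cases a <;> simp_all [cost, ind]
      simp only [nextAge, hla, if_false, PNat.add_coe, PNat.one_coe]
      linarith
  set f : State → Action := fun s => s.2 && decide (m ≤ (s.1 : ℕ)) with hf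
  have heq : ∀ s, cost C s (f s) +
      ((p : ℝ) * H (nextAge s (f s), true) + (1 - p) * H (nextAge s (f s), false)) =
        ρ + H s := by
    rintro ⟨x, l⟩
    rw [hHavg]
    cases l
    · simp [hHdef, hf, cost, nextAge, ind]; ring
    · rcases le_or_gt m (x : ℕ) with h | h
      · have := (hV x x.pos).2.2.2.1 h
        simp [hHdef, hf, cost, nextAge, ind, h, hV1, min_eq_right this]; ring
      · have := (hV x x.pos).2.2.2.2 h
        simp [hHdef, hf, cost, nextAge, ind, not_le.2 h, min_eq_left this]; ring
  refine ⟨stationary f, ⟨f, rfl, ⟨m, hm⟩, fun x l => ?_⟩, fun s₀ ν => ?_⟩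
  · simp only [hf, Bool.and_eq_true, decide_eq_true_eq]
    rfl
  · refine (averageCost_stationary_le p hC f s₀ (ρ := ENNReal.ofReal ρ)
      (H := fun s => ENNReal.ofReal (H s)) ENNReal.ofReal_ne_top fun s => ?_).trans
      (le_averageCost_of_real p hC ν s₀ hρ (K := 2 + 2 * K) (by linarith) hH0 (fun s => ?_) hsub)
    · rw [expect_transition p s (f s) H hH0, ← ENNReal.ofReal_add hρ (hH0 s), ← heq s,
        ENNReal.ofReal_add (cost_nonneg hC s _)
          (add_nonneg (mul_nonneg p.2.1 (hH0 _)) (mul_nonneg hq (hH0 _)))]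
    · have h1 := hHle s
      have h2 := (hV ((s.1 : ℕ) + 1) (by omega)).2.1
      have h3 : (1 : ℝ) ≤ (s.1 : ℕ) := Nat.one_le_cast.2 s.1.pos
      push_cast at h2
      nlinarith

end AgeMDP

theorem theorem2 (p : unitInterval) (C : ℝ) (hC : 0 ≤ C) :
    ∃ μ : AgeMDP.Policy, AgeMDP.IsThresholdType μ ∧ AgeMDP.IsCostOptimal p C μ := by
  rcases p.2.1.eq_or_lt with h | h
  · obtain rfl : p = 0 := Subtype.ext h.symm
    refine ⟨AgeMDP.stationary fun s => s.2, ⟨_, rfl, 1, fun x l => ?_⟩, fun s₀ ν => ?_⟩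
    · simp
    · rw [AgeMDP.averageCost_eq_top_of_eq_zero hC ν s₀]
      exact le_top
  · exact AgeMDP.exists_isThresholdType_isCostOptimal h hC
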